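/- Let $\Pi=\{x\in\mathbb{R}^3 : x_1^2+x_2^2>1\}$, write $\|\cdot\|_p$ for the norm of $L^p(\Pi)$, and let $W^{1,q}(\Pi)$ be the Sobolev space of functions $\phi\in L^q(\Pi)$, with values in a finite-dimensional real normed space (for instance real-valued), whose weak gradient $\nabla\phi=(\partial_1\phi,\partial_2\phi,\partial_3\phi)$ lies in $L^q(\Pi)$, where $|\nabla\phi|=(\sum_i|\partial_i\phi|^2)^{1/2}$; its norm is $\|\phi\|_{1,q}=\|\phi\|_q+\|\nabla\phi\|_q$. Let $W^{1,q}_0(\Pi)$ be the space of functions in $W^{1,q}(\Pi)$ vanishing on $\partial\Pi$, that is, with zero trace on $\partial\Pi$. Let $1\le q\le p\le\infty$ be such that $\sigma=3\left(\frac1q-\frac1p\right)<1$ (with $\frac1\infty=0$, and with the convention $0^0=1$ when $\sigma=0$). Then there is a constant $C$, depending only on $p$, $q$ and the space of values, such that $$\|\varphi\|_p\le C\,\|\varphi\|_q^{1-\sigma}\,\|\nabla\varphi\|_q^{\sigma}\qquad\text{for all }\varphi\in W^{1,q}_0(\Pi),$$ $$\|\phi\|_p\le C\,\|\phi\|_q^{1-\sigma}\,\|\phi\|_{1,q}^{\sigma}\qquad\text{for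 all }\phi\in W^{1,q}(\Pi).$$ -/

import Mathlib

open MeasureTheory Filter Topology Set
open scoped ENNReal NNReal ContDiff

/-- Three-dimensional Euclidean space. -/
abbrev E3 : Type := EuclideanSpace ℝ (Fin 3)

/-- The exterior of the infinite cylinder of radius one,
`Π = {x = (x₁, x₂, x₃) : |(x₁, x₂)| > 1}`. -/
def exteriorCylinder : Set E3 := {x | 1 < √(x 0 ^ 2 + x 1 ^ 2)}

/-- Lebesgue measure on `Π`. -/
noncomputable def cylVolume : Measure E3 := volume.restrict exteriorCylinder

/-- The surface measure of `∂Π = {|(x₁, x₂)| = 1}`: the image of `dθ dz` on `(-π, π) × ℝ`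
under `(θ, z) ↦ (cos θ, sin θ, z)` (the area density of this parametrization is one). -/
noncomputable def cylSurface : Measure E3 :=
  Measure.map (fun y : ℝ × ℝ => (!₂[Real.cos y.1, Real.sin y.1, y.2] : E3))
    (volume.restrict (Ioo (-Real.pi) Real.pi ×ˢ (univ : Set ℝ)))

section Sobolev

variable {F : Type*} [NormedAddCommGroup F] [NormedSpace ℝ F]

/-- The space of values of the gradient `(∂₁φ, ∂₂φ, ∂₃φ)` of an `F`-valued function, with the
norm `(|∂₁φ|² + |∂₂φ|² + |∂₃φ|²)^{1/2}`. -/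
abbrev GradSpace (F : Type*) : Type _ := PiLp 2 (fun _ : Fin 3 => F)

/-- The partial derivative `∂ᵢ u` of a differentiable function. -/
noncomputable def partialDeriv (i : Fin 3) (u : E3 → F) (x : E3) : F :=
  fderiv ℝ u x (EuclideanSpace.single i 1)

/-- The gradient `∇u = (∂₁u, ∂₂u, ∂₃u)` of a differentiable function. -/
noncomputable def classicalGrad (u : E3 → F) (x : E3) : GradSpace F :=
  WithLp.toLp 2 (fun i => partialDeriv i u x)

/-- `G` is the weak gradient of `φ` in `Π`: both are locally integrable in `Π` and
`∫_Π (∂ᵢψ) φ dx = - ∫_Π ψ Gᵢ dx` for `i = 1, 2, 3` and every `ψ ∈ C_c^∞(Π)`.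
It is unique up to equality almost everywhere in `Π`. -/
structure IsWeakGradient (φ : E3 → F) (G : E3 → GradSpace F) : Prop where
  locallyIntegrable : LocallyIntegrableOn φ exteriorCylinder volume
  locallyIntegrable_grad : LocallyIntegrableOn G exteriorCylinder volume
  integral_eq : ∀ ψ : E3 → ℝ, ContDiff ℝ ∞ ψ → HasCompactSupport ψ →
    tsupport ψ ⊆ exteriorCylinder → ∀ i : Fin 3,
      ∫ x, partialDeriv i ψ x • φ x ∂cylVolume = - ∫ x, ψ x • G x i ∂cylVolume

/-- `φ ∈ W^{1,q}(Π)`. -/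
def MemW1 (q : ℝ≥0∞) (φ : E3 → F) : Prop :=
  MemLp φ q cylVolume ∧ ∃ G : E3 → GradSpace F, IsWeakGradient φ G ∧ MemLp G q cylVolume

/-- `g` is the trace of `φ` on `∂Π`. The trace operator is the continuous extension of
`u ↦ u|_{∂Π}` from functions `u` smooth up to the boundary: there are smooth `u n` such that
`u n → φ` in `W^{1,1}` on bounded pieces of `Π` and `u n|_{∂Π} → g` in `L¹` on bounded pieces
of `∂Π`. Convergence is taken locally in order to have one definition that covers all of
`W^{1,q}(Π)`, `1 ≤ q ≤ ∞`; it gives the same trace as the operator `W^{1,q}(Π) → L^q(∂Π)`. -/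
def HasBoundaryTrace (φ g : E3 → F) : Prop :=
  AEStronglyMeasurable g cylSurface ∧
  ∃ G : E3 → GradSpace F, IsWeakGradient φ G ∧
  ∃ u : ℕ → E3 → F, (∀ n, ContDiff ℝ ∞ (u n)) ∧ ∀ R : ℝ, 0 < R →
    Tendsto (fun n => eLpNorm (fun x => u n x - φ x) 1
      (cylVolume.restrict (Metric.ball 0 R))) atTop (𝓝 0) ∧
    Tendsto (fun n => eLpNorm (fun x => classicalGrad (u n) x - G x) 1
      (cylVolume.restrict (Metric.ball 0 R))) atTop (𝓝 0) ∧
    Tendsto (fun n => eLpNorm (fun x => u n x - g x) 1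
      (cylSurface.restrict (Metric.ball 0 R))) atTop (𝓝 0)

/-- `φ ∈ W^{1,q}_0(Π)`: a function in `W^{1,q}(Π)` that vanishes on `∂Π`. -/
def MemW10 (q : ℝ≥0∞) (φ : E3 → F) : Prop :=
  MemW1 q φ ∧ HasBoundaryTrace φ (fun _ => 0)

end Sobolev

/-! Every point of the exterior Π is the vertex of an infinite circular cone contained in Π, of
fixed aperture and with one of four horizontal axes. Let k_R be a nonnegative kernel supported in
such a cone and in the ball of radius R, with mass independent of R. Then k_R - k_r is minus the
divergence of w(y) y, where w(y) = ρ(y) (χ(|y|/R) - χ(|y|/r)), χ is a radial cutoff and ρ is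
homogeneous of degree -3, so that ρ(y) y is divergence free off the origin. Translated to the vertex
x, w(y) y is an admissible test field, and the weak gradient compares the means of φ at the scales r
and R. Letting r → 0 at a Lebesgue point gives, for every R > 0, |φ(x)| ≤ A ∫_{y ∈ Π, |x-y| < R}
|x-y|⁻² (R⁻¹ |φ(y)| + |∇φ(y)|) dy (`exists_enorm_le_lintegral_rieszKernel`).

Young's inequality with 1/s = 1 - σ/3 turns this into a bound of norms. The truncated kernel lies in
L^s because σ < 1 means s < 3/2, and its norm is a multiple of R^{1-σ}; hence ‖φ‖_p ≤ K R^{1-σ} (R⁻¹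
‖φ‖_q + ‖∇φ‖_q) (`exists_eLpNorm_le_at_scale`). The cones being infinite, R is free, and R = ‖φ‖_q /
‖∇φ‖_q yields the homogeneous inequality on all of W^{1,q}(Π), which implies both claims. -/

/-! ### Young's convolution inequality. -/

section Young

variable {E : Type*} [MeasurableSpace E] [AddCommGroup E] [MeasurableAdd₂ E] {μ : Measure E}
  [μ.IsAddLeftInvariant]

/-- The convolution of two nonnegative functions has integral the product of the integrals. -/
theorem lintegral_lintegral_sub_mul [MeasurableSub₂ E] [SFinite μ] {k f : E → ℝ≥0∞}
    (hk : Measurable k) (hf : Measurable f) :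
    ∫⁻ x, ∫⁻ y, k (x - y) * f y ∂μ ∂μ = (∫⁻ x, k x ∂μ) * ∫⁻ y, f y ∂μ := by
  have : μ.IsAddRightInvariant := inferInstance
  rw [lintegral_lintegral_swap
    (((hk.comp (measurable_fst.sub measurable_snd)).mul (hf.comp measurable_snd)).aemeasurable)]
  have h (y : E) : ∫⁻ x, k (x - y) * f y ∂μ = (∫⁻ x, k x ∂μ) * f y := by
    rw [lintegral_mul_const _ (by fun_prop), lintegral_sub_right_eq_self]
  simp_rw [h]
  rw [lintegral_const_mul _ hf]

/-- Hölder's inequality for a convolution: the case of Young's inequality with supremum norm. -/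
theorem lintegral_sub_mul_le_of_holderConjugate [MeasurableNeg E] [μ.IsNegInvariant] {q s : ℝ}
    (hsq : s.HolderConjugate q)
    {k f : E → ℝ≥0∞} (hk : Measurable k) (hf : AEMeasurable f μ) (x : E) :
    ∫⁻ y, k (x - y) * f y ∂μ ≤
      (∫⁻ y, k y ^ s ∂μ) ^ (1 / s) * (∫⁻ y, f y ^ q ∂μ) ^ (1 / q) := by
  have h := ENNReal.lintegral_mul_le_Lp_mul_Lq μ hsq (f := fun y => k (x - y)) (g := f)
    (by fun_prop) hf
  rwa [lintegral_sub_left_eq_self (fun y => k y ^ s)] at h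

/-- **Young's convolution inequality** for nonnegative functions and finite exponents. -/
theorem lintegral_rpow_lintegral_sub_mul_le [MeasurableSub₂ E] [MeasurableNeg E] [SFinite μ]
    [μ.IsNegInvariant] {p q s : ℝ} (hs : 0 < s) (hq : 0 < q) (hsp : s ≤ p)
    (hqp : q ≤ p) (h : 1 + 1 / p = 1 / q + 1 / s) {k f : E → ℝ≥0∞} (hk : Measurable k)
    (hf : AEMeasurable f μ) :
    (∫⁻ x, (∫⁻ y, k (x - y) * f y ∂μ) ^ p ∂μ) ^ (1 / p) ≤
      (∫⁻ y, k y ^ s ∂μ) ^ (1 / s) * (∫⁻ y, f y ^ q ∂μ) ^ (1 / q) := by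
  wlog hf' : Measurable f generalizing f
  · have e1 (x : E) : ∫⁻ y, k (x - y) * f y ∂μ = ∫⁻ y, k (x - y) * hf.mk f y ∂μ :=
      lintegral_congr_ae (by filter_upwards [hf.ae_eq_mk] with y hy; rw [hy])
    have e2 : ∫⁻ y, f y ^ q ∂μ = ∫⁻ y, hf.mk f y ^ q ∂μ :=
      lintegral_congr_ae (by filter_upwards [hf.ae_eq_mk] with y hy; rw [hy])
    simp_rw [e1]
    rw [e2]
    exact this hf.measurable_mk.aemeasurable hf.measurable_mk
  have hp : 0 < p := hs.trans_le hsp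
  have hw2 : 0 ≤ 1 / s - 1 / p := sub_nonneg.2 (one_div_le_one_div_of_le hs hsp)
  have hw3 : 0 ≤ 1 / q - 1 / p := sub_nonneg.2 (one_div_le_one_div_of_le hq hqp)
  have hp1 : 0 ≤ 1 / p := by positivity
  set B := ∫⁻ y, k y ^ s ∂μ
  set D := ∫⁻ y, f y ^ q ∂μ
  have key (x : E) : (∫⁻ y, k (x - y) * f y ∂μ) ^ p ≤
      (∫⁻ y, k (x - y) ^ s * f y ^ q ∂μ) *
        (B ^ ((1 / s - 1 / p) * p) * D ^ ((1 / q - 1 / p) * p)) := by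
    -- Three-factor Hölder for kf = (k^s f^q)^{1/p} (k^s)^{1/s-1/p} (f^q)^{1/q-1/p}; the weights sum
    -- to one by `h`.
    have H := ENNReal.lintegral_prod_norm_pow_le (μ := μ) (Finset.univ : Finset (Fin 3))
      (f := ![fun y => k (x - y) ^ s * f y ^ q, fun y => k (x - y) ^ s, fun y => f y ^ q])
      (p := ![1 / p, 1 / s - 1 / p, 1 / q - 1 / p])
      (by
        intro i _
        fin_cases i <;> simp <;> fun_prop)
      (by
        simp [Fin.sum_univ_three]
        simp at h
        linarith)
      (by
        intro i _
        fin_cases i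
        · exact hp1
        · exact hw2
        · exact hw3)
    simp only [Fin.prod_univ_three, Matrix.cons_val] at H
    rw [lintegral_sub_left_eq_self (fun y => k y ^ s)] at H
    have e (y : E) : (k (x - y) ^ s * f y ^ q) ^ (1 / p) * (k (x - y) ^ s) ^ (1 / s - 1 / p) *
        (f y ^ q) ^ (1 / q - 1 / p) = k (x - y) * f y := by
      calc _ = ((k (x - y) ^ s) ^ (1 / p) * (k (x - y) ^ s) ^ (1 / s - 1 / p)) *
            ((f y ^ q) ^ (1 / p) * (f y ^ q) ^ (1 / q - 1 / p)) := by
            rw [ENNReal.mul_rpow_of_nonneg _ _ hp1, mul_assoc, mul_mul_mul_comm]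
        _ = _ := by
            rw [← ENNReal.rpow_add_of_nonneg _ _ hp1 hw2, ← ENNReal.rpow_add_of_nonneg _ _ hp1 hw3,
              add_sub_cancel, add_sub_cancel, ← ENNReal.rpow_mul, ← ENNReal.rpow_mul,
              mul_one_div_cancel hq.ne', mul_one_div_cancel hs.ne', ENNReal.rpow_one,
              ENNReal.rpow_one]
    simp_rw [e] at H
    calc (∫⁻ y, k (x - y) * f y ∂μ) ^ p ≤ _ := ENNReal.rpow_le_rpow H hp.le
      _ = _ := by
        rw [ENNReal.mul_rpow_of_nonneg _ _ hp.le, ENNReal.mul_rpow_of_nonneg _ _ hp.le,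
          ← ENNReal.rpow_mul, ← ENNReal.rpow_mul, ← ENNReal.rpow_mul, one_div_mul_cancel hp.ne',
          ENNReal.rpow_one, mul_assoc]
  calc (∫⁻ x, (∫⁻ y, k (x - y) * f y ∂μ) ^ p ∂μ) ^ (1 / p)
      ≤ (∫⁻ x, (∫⁻ y, k (x - y) ^ s * f y ^ q ∂μ) *
        (B ^ ((1 / s - 1 / p) * p) * D ^ ((1 / q - 1 / p) * p)) ∂μ) ^ (1 / p) :=
        ENNReal.rpow_le_rpow (lintegral_mono key) hp1
    _ = (B * D * (B ^ ((1 / s - 1 / p) * p) * D ^ ((1 / q - 1 / p) * p))) ^ (1 / p) := by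
        rw [lintegral_mul_const, lintegral_lintegral_sub_mul (k := fun y => k y ^ s)
          (f := fun y => f y ^ q) (by fun_prop) (by fun_prop)]
        exact Measurable.lintegral_prod_right' (f := fun z : E × E => k (z.1 - z.2) ^ s * f z.2 ^ q)
          (by fun_prop)
    _ = B ^ (1 / s) * D ^ (1 / q) := by
        rw [mul_mul_mul_comm, ENNReal.mul_rpow_of_nonneg _ _ hp1, ENNReal.mul_rpow_of_nonneg _ _ hp1,
          ENNReal.mul_rpow_of_nonneg _ _ hp1, ← ENNReal.rpow_mul, ← ENNReal.rpow_mul,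
          mul_assoc (1 / s - 1 / p), mul_assoc (1 / q - 1 / p), mul_one_div_cancel hp.ne',
          mul_one, mul_one,
          ← ENNReal.rpow_add_of_nonneg _ _ hp1 hw2, ← ENNReal.rpow_add_of_nonneg _ _ hp1 hw3,
          add_sub_cancel, add_sub_cancel]

end Young

/-! ### The truncated Riesz kernel: integrability and scaling. -/

section RieszKernel

/-- The kernel `|y|⁻²` on `ℝ³`, truncated to the ball of radius `R`. -/
noncomputable def rieszKernel (R : ℝ) : E3 → ℝ≥0∞ :=
  (Metric.ball 0 R).indicator fun y => ENNReal.ofReal (‖y‖⁻¹ ^ 2)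

theorem measurable_rieszKernel (R : ℝ) : Measurable (rieszKernel R) :=
  Measurable.indicator (by fun_prop) measurableSet_ball

/-- In dimension three |y|^{-2s} is integrable at the origin because 2s < 3. -/
theorem lintegral_rieszKernel_rpow_lt_top {s : ℝ} (hs : 0 < s) (hs' : s < 3 / 2) :
    ∫⁻ y, rieszKernel 1 y ^ s < ⊤ := by
  have hI : IntegrableOn (fun y : E3 => ‖y‖ ^ (-(2 * s))) (Metric.ball 0 1) :=
    integrableOn_ball_of_norm_le_rpow (C := 1) (α := 2 * s) (by simp) (by simp; linarith)
      (ae_of_all _ fun x => by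
        rw [one_mul, Real.norm_of_nonneg (by positivity)])
      (measurable_norm.pow_const _).aestronglyMeasurable
  have h := hI.lintegral_lt_top
  rw [← lintegral_indicator measurableSet_ball] at h
  refine lt_of_le_of_lt (lintegral_mono_ae ?_) h
  filter_upwards [Measure.ae_ne volume (0 : E3)] with y hy
  have hy0 : 0 < ‖y‖ := norm_pos_iff.2 hy
  unfold rieszKernel
  by_cases hb : y ∈ Metric.ball (0 : E3) 1
  · rw [indicator_of_mem hb, indicator_of_mem hb, ENNReal.ofReal_rpow_of_nonneg (by positivity) hs.le,
      ← Real.rpow_natCast, ← Real.rpow_mul (by positivity), Real.inv_rpow hy0.le,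
      ← Real.rpow_neg hy0.le]
    simp
  · rw [indicator_of_notMem hb, indicator_of_notMem hb, ENNReal.zero_rpow_of_pos hs]

theorem rieszKernel_smul {R : ℝ} (hR : 0 < R) (y : E3) :
    rieszKernel R (R • y) = ENNReal.ofReal (R⁻¹ ^ 2) * rieszKernel 1 y := by
  have hmem : R • y ∈ Metric.ball (0 : E3) R ↔ y ∈ Metric.ball (0 : E3) 1 := by
    simp [norm_smul, abs_of_pos hR, hR]
  unfold rieszKernel
  by_cases hb : y ∈ Metric.ball (0 : E3) 1
  · rw [indicator_of_mem hb, indicator_of_mem (hmem.2 hb), ← ENNReal.ofReal_mul (by positivity),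
      norm_smul, Real.norm_of_nonneg hR.le, mul_inv, mul_pow]
  · rw [indicator_of_notMem hb, indicator_of_notMem (hmem.not.2 hb), mul_zero]

theorem lintegral_rieszKernel_rpow {s R : ℝ} (hs : 0 < s) (hR : 0 < R) :
    ∫⁻ y, rieszKernel R y ^ s = ENNReal.ofReal (R ^ (3 - 2 * s)) * ∫⁻ y, rieszKernel 1 y ^ s := by
  have hmap := Measure.map_addHaar_smul (volume : Measure E3) (inv_ne_zero hR.ne')
  have h1 : ∫⁻ y, rieszKernel R y ^ s
      = ∫⁻ y, rieszKernel R (R • y) ^ s ∂(Measure.map (fun x : E3 => R⁻¹ • x) volume) := by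
    rw [lintegral_map (f := fun y => rieszKernel R (R • y) ^ s)
      (((measurable_rieszKernel R).comp (measurable_const_smul R)).pow_const s)
      (measurable_const_smul _)]
    simp_rw [smul_inv_smul₀ hR.ne']
  rw [h1, hmap, lintegral_smul_measure]
  simp_rw [rieszKernel_smul hR, ENNReal.mul_rpow_of_nonneg _ _ hs.le]
  rw [lintegral_const_mul _ ((measurable_rieszKernel 1).pow_const s), smul_eq_mul, ← mul_assoc,
    ENNReal.ofReal_rpow_of_nonneg (by positivity) hs.le, ← ENNReal.ofReal_mul (by positivity)]
  congr 2
  rw [abs_of_nonneg (by positivity), finrank_euclideanSpace_fin, ← inv_pow, inv_inv,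
    ← Real.rpow_natCast, ← Real.rpow_natCast, ← Real.rpow_mul (by positivity),
    Real.inv_rpow hR.le, ← Real.rpow_neg hR.le, ← Real.rpow_add hR]
  norm_num
  ring_nf

end RieszKernel

/-! ### Kernels supported in a cone, and the vector field that joins two scales. -/

section ConeKernel

/-- A smooth function on the half-line, equal to `1` up to `1/2` and to `0` from `1` on. -/
noncomputable def radialCutoff (t : ℝ) : ℝ := Real.smoothTransition (2 - 2 * t)

theorem contDiff_radialCutoff : ContDiff ℝ ∞ radialCutoff :=
  Real.smoothTransition.contDiff.comp (by fun_prop)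

theorem radialCutoff_nonneg (t : ℝ) : 0 ≤ radialCutoff t := Real.smoothTransition.nonneg _

theorem radialCutoff_le_one (t : ℝ) : radialCutoff t ≤ 1 := Real.smoothTransition.le_one _

theorem radialCutoff_eq_one {t : ℝ} (h : t ≤ 1 / 2) : radialCutoff t = 1 :=
  Real.smoothTransition.one_of_one_le (by linarith)

theorem radialCutoff_eq_zero {t : ℝ} (h : 1 ≤ t) : radialCutoff t = 0 :=
  Real.smoothTransition.zero_of_nonpos (by linarith)

theorem antitone_radialCutoff : Antitone radialCutoff := fun _ _ h =>
  Real.smoothTransition.monotone (by linarith)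

theorem deriv_radialCutoff_nonpos (t : ℝ) : deriv radialCutoff t ≤ 0 :=
  antitone_radialCutoff.deriv_nonpos

theorem continuous_deriv_radialCutoff : Continuous (deriv radialCutoff) :=
  contDiff_radialCutoff.continuous_deriv (by simp)

/-- The maximum value 1 is attained at such a point, so the derivative vanishes there, the endpoint
1/2 included. -/
theorem deriv_radialCutoff_of_le {t : ℝ} (h : t ≤ 1 / 2) : deriv radialCutoff t = 0 :=
  IsLocalMax.deriv_eq_zero (Eventually.of_forall fun s => by
    rw [radialCutoff_eq_one h]; exact radialCutoff_le_one s)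

theorem deriv_radialCutoff_of_ge {t : ℝ} (h : 1 ≤ t) : deriv radialCutoff t = 0 :=
  IsLocalMin.deriv_eq_zero (Eventually.of_forall fun s => by
    rw [radialCutoff_eq_zero h]; exact radialCutoff_nonneg s)

theorem exists_abs_deriv_radialCutoff_le : ∃ M : ℝ, 0 < M ∧ ∀ t, |deriv radialCutoff t| ≤ M := by
  obtain ⟨M, hM⟩ := (isCompact_Icc (a := (0 : ℝ)) (b := 1)).exists_bound_of_continuousOn
    continuous_deriv_radialCutoff.continuousOn
  refine ⟨max M 1, by positivity, fun t => ?_⟩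
  by_cases ht : t ∈ Icc (0 : ℝ) 1
  · exact (hM t ht).trans (le_max_left _ _)
  · have : deriv radialCutoff t = 0 := by
      rw [mem_Icc, not_and_or, not_le, not_le] at ht
      rcases ht with h | h
      · exact deriv_radialCutoff_of_le (by linarith)
      · exact deriv_radialCutoff_of_ge h.le
    rw [this, abs_zero]
    positivity

/-- The mean value theorem on [1/2, 1], where the slope is -2. It keeps the mass of the mollifier
from being zero. -/
theorem exists_deriv_radialCutoff_neg : ∃ t : ℝ, 0 < t ∧ deriv radialCutoff t < 0 := by
  obtain ⟨t, ht, h⟩ := exists_deriv_eq_slope radialCutoff (a := 1 / 2) (b := 1) (by norm_num)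
    contDiff_radialCutoff.continuous.continuousOn
    (contDiff_radialCutoff.differentiable (by simp)).differentiableOn
  refine ⟨t, by linarith [ht.1], ?_⟩
  rw [h, radialCutoff_eq_one le_rfl, radialCutoff_eq_zero le_rfl]
  norm_num

/-- A function on `ℝ³`, homogeneous of degree `-3`, smooth away from the origin, and supported in
a cone about the direction `n`. -/
noncomputable def coneDensity (n y : E3) : ℝ :=
  ‖y‖⁻¹ ^ 3 * Real.smoothTransition (10 * (inner ℝ y n * ‖y‖⁻¹ - 4 / 5))

theorem coneDensity_nonneg (n y : E3) : 0 ≤ coneDensity n y :=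
  mul_nonneg (by positivity) (Real.smoothTransition.nonneg _)

theorem coneDensity_le (n y : E3) : coneDensity n y ≤ ‖y‖⁻¹ ^ 3 :=
  mul_le_of_le_one_right (by positivity) (Real.smoothTransition.le_one _)

/-- For a unit vector n, the transition vanishes up to cosine 4/5 of the angle with n and equals one
from cosine 9/10. The bound 4/5 exceeds cos 45°, as the geometry of the cylinder requires. -/
theorem le_inner_of_coneDensity_ne_zero {n y : E3} (h : coneDensity n y ≠ 0) :
    4 / 5 * ‖y‖ ≤ inner ℝ y n := by
  by_contra! hlt
  rcases eq_or_ne y 0 with rfl | hy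
  · simp at hlt
  · refine h ?_
    have hy0 : 0 < ‖y‖ := norm_pos_iff.2 hy
    have : inner ℝ y n * ‖y‖⁻¹ < 4 / 5 := by
      rwa [← div_eq_mul_inv, div_lt_iff₀ hy0]
    rw [coneDensity, Real.smoothTransition.zero_of_nonpos (by linarith), mul_zero]

theorem coneDensity_smul (n y : E3) {s : ℝ} (hs : 0 < s) :
    coneDensity n (s • y) = s⁻¹ ^ 3 * coneDensity n y := by
  have : inner ℝ (s • y) n * ‖s • y‖⁻¹ = inner ℝ y n * ‖y‖⁻¹ := by
    rw [real_inner_smul_left, norm_smul, Real.norm_of_nonneg hs.le, mul_inv]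
    field_simp
  rw [coneDensity, coneDensity, this, norm_smul, Real.norm_of_nonneg hs.le, mul_inv, mul_pow,
    mul_assoc]

theorem contDiffAt_coneDensity (n : E3) {y : E3} (hy : y ≠ 0) :
    ContDiffAt ℝ ∞ (coneDensity n) y := by
  have h1 : ContDiffAt ℝ ∞ (fun y : E3 => ‖y‖⁻¹) y :=
    (contDiffAt_norm ℝ hy).inv (norm_ne_zero_iff.2 hy)
  have h2 : ContDiffAt ℝ ∞ (fun y : E3 => inner ℝ y n) y := contDiffAt_id.inner ℝ contDiffAt_const
  exact (h1.pow 3).mul (Real.smoothTransition.contDiffAt.comp y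
    (contDiffAt_const.mul ((h2.mul h1).sub contDiffAt_const)))

theorem measurable_coneDensity (n : E3) : Measurable (coneDensity n) := by
  have : Measurable Real.smoothTransition := Real.smoothTransition.continuous.measurable
  unfold coneDensity
  fun_prop

/-- The density `coneDensity` cut off at distance `R`. -/
noncomputable def conePotential (n : E3) (R : ℝ) (y : E3) : ℝ :=
  coneDensity n y * radialCutoff (R⁻¹ * ‖y‖)

/-- A nonnegative function supported in a cone and in the ball of radius `R`: minus the divergence
of `conePotential n R y • y` away from the origin. -/
noncomputable def coneMollifier (n : E3) (R : ℝ) (y : E3) : ℝ :=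
  -(coneDensity n y * (R⁻¹ * ‖y‖) * deriv radialCutoff (R⁻¹ * ‖y‖))

theorem coneMollifier_nonneg (n : E3) {R : ℝ} (hR : 0 < R) (y : E3) :
    0 ≤ coneMollifier n R y := by
  rw [coneMollifier, ← mul_neg]
  exact mul_nonneg (mul_nonneg (coneDensity_nonneg n y) (by positivity))
    (neg_nonneg.2 (deriv_radialCutoff_nonpos _))

theorem coneMollifier_eq_zero (n : E3) {R : ℝ} (hR : 0 < R) {y : E3} (hy : R ≤ ‖y‖) :
    coneMollifier n R y = 0 := by
  rw [coneMollifier, deriv_radialCutoff_of_ge, mul_zero, neg_zero]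
  rw [← div_eq_inv_mul, le_div_iff₀ hR]
  linarith

theorem coneMollifier_le {M : ℝ} (hM : ∀ t, |deriv radialCutoff t| ≤ M) (n : E3) {R : ℝ}
    (hR : 0 < R) (y : E3) : coneMollifier n R y ≤ M * R⁻¹ * ‖y‖⁻¹ ^ 2 := by
  have hM0 : 0 ≤ M := (abs_nonneg _).trans (hM 0)
  calc coneMollifier n R y
      = coneDensity n y * (R⁻¹ * ‖y‖) * -deriv radialCutoff (R⁻¹ * ‖y‖) := by
        rw [coneMollifier, mul_neg]
    _ ≤ ‖y‖⁻¹ ^ 3 * (R⁻¹ * ‖y‖) * M := by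
        gcongr
        · exact neg_nonneg.2 (deriv_radialCutoff_nonpos _)
        · exact coneDensity_le n y
        · exact (neg_le_abs _).trans (hM _)
    _ = M * R⁻¹ * ‖y‖⁻¹ ^ 2 := by
        rcases eq_or_ne y 0 with rfl | hy
        · simp
        · have : ‖y‖ ≠ 0 := norm_ne_zero_iff.2 hy
          field_simp

/-- The derivative of the cutoff removes the ball of radius R/2, so the singularity at the vertex is
never seen. This is the bound by a multiple of 1/|B_R| needed at Lebesgue points. -/
theorem coneMollifier_le_const {M : ℝ} (hM : ∀ t, |deriv radialCutoff t| ≤ M) (n : E3) {R : ℝ}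
    (hR : 0 < R) (y : E3) : coneMollifier n R y ≤ 4 * M * R⁻¹ ^ 3 := by
  have hM0 : 0 ≤ M := (abs_nonneg _).trans (hM 0)
  rcases le_or_gt (R⁻¹ * ‖y‖) (1 / 2) with h | h
  · rw [coneMollifier, deriv_radialCutoff_of_le h, mul_zero, neg_zero]
    positivity
  · have hy : R / 2 < ‖y‖ := by
      rw [← div_eq_inv_mul, lt_div_iff₀ hR] at h
      linarith
    have : ‖y‖⁻¹ ≤ 2 * R⁻¹ := by
      calc ‖y‖⁻¹ ≤ (R / 2)⁻¹ := by gcongr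
        _ = 2 * R⁻¹ := by field_simp
    calc coneMollifier n R y ≤ M * R⁻¹ * ‖y‖⁻¹ ^ 2 := coneMollifier_le hM n hR y
      _ ≤ M * R⁻¹ * (2 * R⁻¹) ^ 2 := by gcongr
      _ = 4 * M * R⁻¹ ^ 3 := by ring

theorem measurable_coneMollifier (n : E3) (R : ℝ) : Measurable (coneMollifier n R) := by
  have h1 := measurable_coneDensity n
  have h2 := continuous_deriv_radialCutoff.measurable
  unfold coneMollifier
  fun_prop

theorem coneMollifier_smul (n : E3) {R : ℝ} (hR : 0 < R) (y : E3) :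
    coneMollifier n R (R • y) = R⁻¹ ^ 3 * coneMollifier n 1 y := by
  rw [coneMollifier, coneMollifier, coneDensity_smul n y hR, norm_smul, Real.norm_of_nonneg hR.le,
    inv_mul_cancel_left₀ hR.ne']
  simp
  ring

/-- The factor R⁻³ from homogeneity matches the Jacobian of the dilation. -/
theorem integral_coneMollifier (n : E3) {R : ℝ} (hR : 0 < R) :
    ∫ y, coneMollifier n R y = ∫ y, coneMollifier n 1 y := by
  have h := Measure.integral_comp_smul volume (coneMollifier n R) R
  simp_rw [coneMollifier_smul n hR] at h
  rw [integral_const_mul, finrank_euclideanSpace_fin, abs_of_nonneg (by positivity), ← inv_pow,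
    smul_eq_mul] at h
  exact (mul_left_cancel₀ (by positivity) h).symm

theorem integrable_coneMollifier (n : E3) {R : ℝ} (hR : 0 < R) :
    Integrable (coneMollifier n R) := by
  obtain ⟨M, hM0, hM⟩ := exists_abs_deriv_radialCutoff_le
  have h : Integrable ((Metric.closedBall (0 : E3) R).indicator fun _ => 4 * M * R⁻¹ ^ 3) :=
    (integrable_indicator_iff measurableSet_closedBall).2
      (integrableOn_const (isCompact_closedBall _ _).measure_lt_top.ne)
  refine h.mono' (measurable_coneMollifier n R).aestronglyMeasurable (ae_of_all _ fun y => ?_)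
  rw [Real.norm_of_nonneg (coneMollifier_nonneg n hR y)]
  by_cases hy : y ∈ Metric.closedBall (0 : E3) R
  · rw [indicator_of_mem hy]
    exact coneMollifier_le_const hM n hR y
  · rw [indicator_of_notMem hy, coneMollifier_eq_zero n hR]
    simpa using (not_le.1 (by simpa using hy)).le

/-- The mollifier is nonnegative, and it is continuous and nonzero at a point t n of the axis where
the cutoff strictly decreases. -/
theorem integral_coneMollifier_pos {n : E3} (hn : ‖n‖ = 1) : 0 < ∫ y, coneMollifier n 1 y := by
  rw [integral_pos_iff_support_of_nonneg (coneMollifier_nonneg n one_pos)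
    (integrable_coneMollifier n one_pos)]
  obtain ⟨t, ht, hneg⟩ := exists_deriv_radialCutoff_neg
  have hne : t • n ≠ 0 := smul_ne_zero ht.ne' (norm_ne_zero_iff.1 (by rw [hn]; exact one_ne_zero))
  have hnorm : ‖t • n‖ = t := by rw [norm_smul, hn, Real.norm_of_nonneg ht.le, mul_one]
  have hcont : ContinuousAt (coneMollifier n 1) (t • n) := by
    have h1 := (contDiffAt_coneDensity n hne).continuousAt
    have h2 : ContinuousAt (fun y : E3 => deriv radialCutoff ((1 : ℝ)⁻¹ * ‖y‖)) (t • n) :=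
      (continuous_deriv_radialCutoff.comp (by fun_prop)).continuousAt
    unfold coneMollifier
    fun_prop
  have hval : coneMollifier n 1 (t • n) ≠ 0 := by
    have h1 : coneDensity n (t • n) ≠ 0 := by
      rw [coneDensity, hnorm, real_inner_smul_left, real_inner_self_eq_norm_sq, hn,
        Real.smoothTransition.one_of_one_le]
      · positivity
      · rw [one_pow, mul_one, mul_inv_cancel₀ ht.ne']
        norm_num
    rw [coneMollifier, hnorm, inv_one, one_mul]
    exact neg_ne_zero.2 (mul_ne_zero (mul_ne_zero h1 ht.ne') hneg.ne)
  exact Measure.measure_pos_of_mem_nhds volume (hcont.eventually_ne hval)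

theorem conePotential_sub_eq_zero {n : E3} {r R : ℝ} (hr : 0 < r) (hrR : r ≤ R) {y : E3}
    (hy : R ≤ ‖y‖) : conePotential n R y - conePotential n r y = 0 := by
  have hR := hr.trans_le hrR
  have h (t : ℝ) (ht : 0 < t) (hty : t ≤ ‖y‖) : conePotential n t y = 0 := by
    rw [conePotential, radialCutoff_eq_zero, mul_zero]
    rw [← div_eq_inv_mul, le_div_iff₀ ht]
    linarith
  rw [h R hR hy, h r hr (hrR.trans hy), sub_zero]

/-- Both cutoffs take values in [0, 1]. The bound does not depend on r, so it survives r → 0. -/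
theorem abs_conePotential_sub_le (n : E3) (r R : ℝ) (y : E3) :
    |conePotential n R y - conePotential n r y| ≤ ‖y‖⁻¹ ^ 3 := by
  rw [conePotential, conePotential, ← mul_sub, abs_mul, abs_of_nonneg (coneDensity_nonneg n y)]
  refine (mul_le_of_le_one_right (coneDensity_nonneg n y) ?_).trans (coneDensity_le n y)
  rw [abs_le]
  constructor <;> linarith [radialCutoff_nonneg (R⁻¹ * ‖y‖), radialCutoff_le_one (R⁻¹ * ‖y‖),
    radialCutoff_nonneg (r⁻¹ * ‖y‖), radialCutoff_le_one (r⁻¹ * ‖y‖)]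

theorem le_inner_of_conePotential_sub_ne_zero {n y : E3} {r R : ℝ}
    (h : conePotential n R y - conePotential n r y ≠ 0) : 4 / 5 * ‖y‖ ≤ inner ℝ y n := by
  refine le_inner_of_coneDensity_ne_zero fun h0 => h ?_
  rw [conePotential, conePotential, h0, zero_mul, zero_mul, sub_zero]

/-- Both cutoffs equal one on the ball of radius r/2, so the singularities at the origin cancel
there. -/
theorem contDiff_conePotential_sub (n : E3) {r R : ℝ} (hr : 0 < r) (hrR : r ≤ R) :
    ContDiff ℝ ∞ fun y => conePotential n R y - conePotential n r y := by
  have hR := hr.trans_le hrR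
  rw [contDiff_iff_contDiffAt]
  intro y
  rcases eq_or_ne y 0 with rfl | hy
  · have : (fun y => conePotential n R y - conePotential n r y) =ᶠ[𝓝 0] fun _ => (0 : ℝ) := by
      filter_upwards [Metric.ball_mem_nhds (0 : E3) (half_pos hr)] with y hy
      have hy' : ‖y‖ < r / 2 := by simpa using hy
      have h (t : ℝ) (ht : 0 < t) (hrt : r ≤ t) : conePotential n t y = coneDensity n y := by
        rw [conePotential, radialCutoff_eq_one, mul_one]
        rw [← div_eq_inv_mul, div_le_iff₀ ht]
        linarith
      rw [h R hR hrR, h r hr le_rfl, sub_self]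
    exact contDiffAt_const.congr_of_eventuallyEq this
  · have h (t : ℝ) : ContDiffAt ℝ ∞ (conePotential n t) y :=
      (contDiffAt_coneDensity n hy).mul (contDiff_radialCutoff.contDiffAt.comp y
        (contDiffAt_const.mul (contDiffAt_norm ℝ hy)))
    exact (h R).sub (h r)

/-- The divergence of the vector field `(conePotential n R y - conePotential n r y) • y`. -/
theorem divergence_conePotential_sub (n : E3) {r R : ℝ} (hr : 0 < r) (hrR : r ≤ R) (y : E3) :
    3 * (conePotential n R y - conePotential n r y) +
      fderiv ℝ (fun y => conePotential n R y - conePotential n r y) y y =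
      -(coneMollifier n R y - coneMollifier n r y) := by
  have hw : DifferentiableAt ℝ (fun y => conePotential n R y - conePotential n r y) y :=
    (contDiff_conePotential_sub n hr hrR).differentiable (by simp) y
  -- The radial derivative is computed along s ↦ s y at s = 1. By homogeneity the density
  -- contributes -3 times the potential, which cancels the term 3w and leaves only the derivatives
  -- of the cutoffs.
  have h1 : HasDerivAt (fun s : ℝ => conePotential n R (s • y) - conePotential n r (s • y))
      (fderiv ℝ (fun y => conePotential n R y - conePotential n r y) y y) 1 := by
    have hs : HasDerivAt (fun s : ℝ => s • y) y 1 := by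
      simpa using (hasDerivAt_id (1 : ℝ)).smul_const y
    have hw' := hw.hasFDerivAt
    rw [← one_smul ℝ y] at hw'
    simpa [Function.comp_def] using hw'.comp_hasDerivAt (1 : ℝ) hs
  have hcut (t : ℝ) : HasDerivAt (fun s : ℝ => radialCutoff (s * (t⁻¹ * ‖y‖)))
      (deriv radialCutoff (t⁻¹ * ‖y‖) * (t⁻¹ * ‖y‖)) 1 := by
    have h := ((contDiff_radialCutoff.differentiable (by simp)) (1 * (t⁻¹ * ‖y‖))).hasDerivAt
    have h' := h.comp (1 : ℝ) ((hasDerivAt_id (1 : ℝ)).mul_const (t⁻¹ * ‖y‖))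
    simpa [Function.comp_def] using h'
  have hpow : HasDerivAt (fun s : ℝ => s⁻¹ ^ 3 * coneDensity n y) (-3 * coneDensity n y) 1 := by
    have h := ((hasDerivAt_inv (one_ne_zero (α := ℝ))).pow 3).mul_const (coneDensity n y)
    simpa using h
  have h2 := hpow.mul ((hcut R).sub (hcut r))
  have h3 : (fun s : ℝ => conePotential n R (s • y) - conePotential n r (s • y)) =ᶠ[𝓝 1]
      (fun s : ℝ => s⁻¹ ^ 3 * coneDensity n y) *
        ((fun s : ℝ => radialCutoff (s * (R⁻¹ * ‖y‖))) -
          fun s : ℝ => radialCutoff (s * (r⁻¹ * ‖y‖))) := by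
    filter_upwards [lt_mem_nhds (zero_lt_one (α := ℝ))] with s hs
    simp only [conePotential, coneDensity_smul n y hs, norm_smul, Real.norm_of_nonneg hs.le,
      mul_left_comm _ s, Pi.mul_apply, Pi.sub_apply]
    ring
  rw [h1.unique (h2.congr_of_eventuallyEq h3)]
  simp only [conePotential, coneMollifier, Pi.sub_apply, one_mul, inv_one, one_pow]
  ring

end ConeKernel

/-! ### Cones in the exterior of the cylinder. -/

section Geometry

theorem isOpen_exteriorCylinder : IsOpen exteriorCylinder :=
  isOpen_lt (by fun_prop) (by fun_prop)

theorem measurableSet_exteriorCylinder : MeasurableSet exteriorCylinder :=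
  isOpen_exteriorCylinder.measurableSet

theorem mem_exteriorCylinder_iff {x : E3} : x ∈ exteriorCylinder ↔ 1 < x 0 ^ 2 + x 1 ^ 2 := by
  rw [exteriorCylinder, mem_ofPred_eq, Real.lt_sqrt zero_le_one, one_pow]

/-- The cross term 2(ac + bd) is nonnegative, so the displacement (c, d) does not decrease the
distance to the axis. -/
theorem one_lt_sq_add_sq_of_abs_le {a b c d : ℝ} (hba : |b| ≤ a) (hdc : |d| ≤ c)
    (h : 1 < a ^ 2 + b ^ 2) : 1 < (a + c) ^ 2 + (b + d) ^ 2 := by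
  have h1 : |b * d| ≤ a * c := by
    rw [abs_mul]
    exact mul_le_mul hba hdc (abs_nonneg _) ((abs_nonneg _).trans hba)
  nlinarith [neg_abs_le (b * d), sq_nonneg c, sq_nonneg d]

/-- The four horizontal coordinate directions. -/
noncomputable def coneDirection (b : Bool × Bool) : E3 :=
  EuclideanSpace.single (if b.1 then 0 else 1) (if b.2 then 1 else -1)

theorem norm_coneDirection (b : Bool × Bool) : ‖coneDirection b‖ = 1 := by
  rw [coneDirection, EuclideanSpace.single, PiLp.norm_single]
  split_ifs <;> simp

/-- Every point of the exterior of the cylinder is the vertex of a cone about one of the four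
horizontal coordinate directions that does not meet the cylinder. -/
theorem exists_cone_subset_exteriorCylinder {x : E3} (hx : x ∈ exteriorCylinder) :
    ∃ b, ∀ v : E3, 4 / 5 * ‖v‖ ≤ inner ℝ v (coneDirection b) → x + v ∈ exteriorCylinder := by
  rw [mem_exteriorCylinder_iff] at hx
  -- Squaring and dropping the vertical component bounds the square of the other horizontal
  -- component by (25/16 - 1) s² ≤ s².
  have key (v : E3) (s : ℝ) (h : 4 / 5 * ‖v‖ ≤ s) :
      0 ≤ s ∧ 16 / 25 * (v 0 ^ 2 + v 1 ^ 2) ≤ s ^ 2 := by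
    have h0 : 0 ≤ 4 / 5 * ‖v‖ := by positivity
    have h1 : ‖v‖ ^ 2 = v 0 ^ 2 + v 1 ^ 2 + v 2 ^ 2 := by
      rw [EuclideanSpace.real_norm_sq_eq, Fin.sum_univ_three]
    have h2 := mul_self_le_mul_self h0 h
    exact ⟨h0.trans h, by nlinarith [sq_nonneg (v 2)]⟩
  simp only [mem_exteriorCylinder_iff, PiLp.add_apply]
  -- The axis of the cone follows the coordinate of larger modulus, with its sign.
  rcases le_total |x 1| |x 0| with h | h
  · rcases le_total 0 (x 0) with h0 | h0
    · refine ⟨(true, true), fun v hv => ?_⟩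
      simp only [coneDirection, EuclideanSpace.inner_single_right, if_true, one_mul,
        conj_trivial] at hv
      obtain ⟨hs, hle⟩ := key v _ hv
      rw [abs_of_nonneg h0] at h
      exact one_lt_sq_add_sq_of_abs_le h (abs_le_of_sq_le_sq (by nlinarith) hs) hx
    · refine ⟨(true, false), fun v hv => ?_⟩
      simp [coneDirection, EuclideanSpace.inner_single_right] at hv
      obtain ⟨hs, hle⟩ := key v (-v 0) (by linarith)
      rw [abs_of_nonpos h0] at h
      have := one_lt_sq_add_sq_of_abs_le (d := v 1) h
        (abs_le_of_sq_le_sq (by nlinarith) hs) (by nlinarith)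
      nlinarith
  · rcases le_total 0 (x 1) with h0 | h0
    · refine ⟨(false, true), fun v hv => ?_⟩
      simp [coneDirection, EuclideanSpace.inner_single_right] at hv
      obtain ⟨hs, hle⟩ := key v (v 1) (by linarith)
      rw [abs_of_nonneg h0] at h
      have := one_lt_sq_add_sq_of_abs_le (d := v 0) h
        (abs_le_of_sq_le_sq (by nlinarith) hs) (by nlinarith)
      nlinarith
    · refine ⟨(false, false), fun v hv => ?_⟩
      simp [coneDirection, EuclideanSpace.inner_single_right] at hv
      obtain ⟨hs, hle⟩ := key v (-v 1) (by linarith)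
      rw [abs_of_nonpos h0] at h
      have := one_lt_sq_add_sq_of_abs_le (d := v 0) h
        (abs_le_of_sq_le_sq (by nlinarith) hs) (by nlinarith)
      nlinarith

end Geometry

/-! ### Pointwise bound by a truncated Riesz potential. -/

section Representation

instance : IsLocallyFiniteMeasure cylVolume := inferInstanceAs
  (IsLocallyFiniteMeasure (volume.restrict exteriorCylinder))

/-- The `i`-th component of the test vector field with vertex `x`. -/
noncomputable def coneTest (n : E3) (r R : ℝ) (x : E3) (i : Fin 3) (y : E3) : ℝ :=
  (y - x) i * (conePotential n R (y - x) - conePotential n r (y - x))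

variable {n x : E3} {r R : ℝ}

theorem contDiff_coneTest (hr : 0 < r) (hrR : r ≤ R) (i : Fin 3) :
    ContDiff ℝ ∞ (coneTest n r R x i) := by
  have h1 : ContDiff ℝ ∞ fun y : E3 => y - x := contDiff_id.sub contDiff_const
  have h2 : ContDiff ℝ ∞ fun y : E3 => y i := by fun_prop
  exact (h2.comp h1).mul ((contDiff_conePotential_sub n hr hrR).comp h1)

theorem tsupport_coneTest_subset (hr : 0 < r) (hrR : r ≤ R) (i : Fin 3) :
    tsupport (coneTest n r R x i) ⊆
      Metric.closedBall x R ∩ {y | 4 / 5 * ‖y - x‖ ≤ inner ℝ (y - x) n} := by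
  refine closure_minimal (fun y hy => ?_)
    (Metric.isClosed_closedBall.inter (isClosed_le (by fun_prop) (by fun_prop)))
  have hne := right_ne_zero_of_mul hy
  refine ⟨?_, le_inner_of_conePotential_sub_ne_zero hne⟩
  rw [mem_closedBall_iff_norm]
  by_contra! h
  exact hne (conePotential_sub_eq_zero hr hrR h.le)

theorem hasCompactSupport_coneTest (hr : 0 < r) (hrR : r ≤ R) (i : Fin 3) :
    HasCompactSupport (coneTest n r R x i) :=
  (isCompact_closedBall x R).of_isClosed_subset (isClosed_tsupport _)
    ((tsupport_coneTest_subset hr hrR i).trans inter_subset_left)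

theorem abs_coneTest_le (hr : 0 < r) (hrR : r ≤ R) (i : Fin 3) (y : E3) :
    |coneTest n r R x i y| ≤ (Metric.ball x R).indicator (fun y => ‖x - y‖⁻¹ ^ 2) y := by
  by_cases hy : y ∈ Metric.ball x R
  · rw [indicator_of_mem hy, coneTest, abs_mul, norm_sub_rev]
    calc |(y - x) i| * |conePotential n R (y - x) - conePotential n r (y - x)|
        ≤ ‖y - x‖ * ‖y - x‖⁻¹ ^ 3 :=
          mul_le_mul (PiLp.norm_apply_le (y - x) i) (abs_conePotential_sub_le n r R _)
            (abs_nonneg _) (norm_nonneg _)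
      _ = ‖y - x‖⁻¹ ^ 2 := by
          rcases eq_or_ne ‖y - x‖ 0 with h | h
          · simp [h]
          · field_simp
  · rw [indicator_of_notMem hy, coneTest, conePotential_sub_eq_zero hr hrR, mul_zero, abs_zero]
    rwa [mem_ball_iff_norm, not_lt] at hy

/-- By the product rule the sum is 3w + Dw(y - x)(y - x), the divergence already computed. -/
theorem sum_partialDeriv_coneTest (hr : 0 < r) (hrR : r ≤ R) (y : E3) :
    ∑ i, partialDeriv i (coneTest n r R x i) y =
      -(coneMollifier n R (y - x) - coneMollifier n r (y - x)) := by
  rw [← divergence_conePotential_sub n hr hrR]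
  set w : E3 → ℝ := fun y => conePotential n R y - conePotential n r y with hw
  have hd : HasFDerivAt w (fderiv ℝ w (y - x)) (y - x) :=
    ((contDiff_conePotential_sub n hr hrR).differentiable (by simp) (y - x)).hasFDerivAt
  have hsub : HasFDerivAt (fun y : E3 => y - x) (ContinuousLinearMap.id ℝ E3) y :=
    (hasFDerivAt_id y).sub_const x
  have h (i : Fin 3) : partialDeriv i (coneTest n r R x i) y =
      (y - x) i * fderiv ℝ w (y - x) (EuclideanSpace.single i 1) + w (y - x) := by
    have h1 : HasFDerivAt (fun y : E3 => (y - x) i) (EuclideanSpace.proj i : E3 →L[ℝ] ℝ) y :=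
      (EuclideanSpace.proj i : E3 →L[ℝ] ℝ).hasFDerivAt.comp y hsub
    have h2 : HasFDerivAt (fun y : E3 => w (y - x)) (fderiv ℝ w (y - x)) y := by
      simpa [Function.comp_def] using HasFDerivAt.comp (g := w) y hd hsub
    have h3 : HasFDerivAt (coneTest n r R x i) _ y := h1.mul h2
    rw [partialDeriv, h3.fderiv]
    simp [hw]
  have hsum : y - x = ∑ i, (y - x) i • EuclideanSpace.single i (1 : ℝ) := by
    ext j
    simp [Finset.sum_apply, Pi.single_apply]
  have hlin : fderiv ℝ w (y - x) (y - x) =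
      ∑ i, (y - x) i * fderiv ℝ w (y - x) (EuclideanSpace.single i 1) := by
    have h := congrArg (fderiv ℝ w (y - x)) hsum
    rw [map_sum] at h
    simpa only [map_smul, smul_eq_mul] using h
  rw [Finset.sum_congr rfl fun i _ => h i, Finset.sum_add_distrib, ← hlin]
  simp
  ring

variable {F : Type*} [NormedAddCommGroup F] [NormedSpace ℝ F]
  {φ : E3 → F} {G : E3 → GradSpace F}

theorem integrable_coneMollifier_smul (hφ : LocallyIntegrable φ cylVolume) (n x : E3) (hR : 0 < R) :
    Integrable (fun y => coneMollifier n R (y - x) • φ y) cylVolume := by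
  obtain ⟨M, hM0, hM⟩ := exists_abs_deriv_radialCutoff_le
  have h1 : IntegrableOn φ (Metric.closedBall x R) cylVolume :=
    hφ.integrableOn_isCompact (isCompact_closedBall x R)
  have h2 : IntegrableOn (fun y => coneMollifier n R (y - x) • φ y) (Metric.closedBall x R)
      cylVolume := by
    refine Integrable.bdd_smul h1 (4 * M * R⁻¹ ^ 3) ?_ (ae_of_all _ fun y => ?_)
    · exact ((measurable_coneMollifier n R).comp (measurable_id.sub_const x)).aestronglyMeasurable
    · rw [Real.norm_of_nonneg (coneMollifier_nonneg n hR _)]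
      exact coneMollifier_le_const hM n hR _
  refine (integrableOn_iff_integrable_of_support_subset fun y hy => ?_).1 h2
  rw [mem_closedBall_iff_norm]
  by_contra! h
  exact hy (by simp [coneMollifier_eq_zero n hR h.le])

/-- The difference of two mollifications of `φ` at the vertex of a cone contained in the domain is
an integral of the weak gradient of `φ` over the cone. -/
theorem integral_coneMollifier_smul_sub (hG : IsWeakGradient φ G)
    (hφ : LocallyIntegrable φ cylVolume) (hG' : LocallyIntegrable G cylVolume)
    (hcone : ∀ v : E3, 4 / 5 * ‖v‖ ≤ inner ℝ v n → x + v ∈ exteriorCylinder)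
    (hr : 0 < r) (hrR : r ≤ R) :
    ∫ y, coneMollifier n r (y - x) • φ y ∂cylVolume =
      ∫ y, coneMollifier n R (y - x) • φ y ∂cylVolume -
        ∫ y, ∑ i, coneTest n r R x i y • G y i ∂cylVolume := by
  have hcd (i : Fin 3) := contDiff_coneTest (n := n) (x := x) hr hrR i
  have hcs (i : Fin 3) := hasCompactSupport_coneTest (n := n) (x := x) hr hrR i
  -- The cone is closed and lies in Π together with its vertex, so even the closed support stays
  -- inside Π.
  have hts (i : Fin 3) : tsupport (coneTest n r R x i) ⊆ exteriorCylinder := fun y hy => by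
    have := hcone (y - x) (tsupport_coneTest_subset hr hrR i hy).2
    rwa [add_sub_cancel] at this
  have hGi (i : Fin 3) : LocallyIntegrable (fun y => G y i) cylVolume := fun y =>
    let ⟨U, hU, h⟩ := hG' y
    ⟨U, hU, (PiLp.proj 2 (fun _ : Fin 3 => F) i : GradSpace F →L[ℝ] F).integrable_comp h⟩
  have h1 (i : Fin 3) : Integrable (fun y => coneTest n r R x i y • G y i) cylVolume :=
    (hGi i).integrable_smul_left_of_hasCompactSupport (hcd i).continuous (hcs i)
  have h2 (i : Fin 3) : Integrable
      (fun y => partialDeriv i (coneTest n r R x i) y • φ y) cylVolume := by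
    refine hφ.integrable_smul_left_of_hasCompactSupport ?_ ((hcs i).fderiv_apply ℝ _)
    exact ((hcd i).continuous_fderiv (by simp)).clm_apply continuous_const
  have h3 := Finset.sum_congr rfl fun i (_ : i ∈ Finset.univ) =>
    hG.integral_eq _ (hcd i) (hcs i) (hts i) i
  rw [Finset.sum_neg_distrib, ← integral_finsetSum _ fun i _ => h1 i,
    ← integral_finsetSum _ fun i _ => h2 i] at h3
  simp_rw [← Finset.sum_smul, sum_partialDeriv_coneTest hr hrR, neg_smul, sub_smul] at h3
  rw [integral_neg, integral_sub (integrable_coneMollifier_smul hφ n x (hr.trans_le hrR))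
    (integrable_coneMollifier_smul hφ n x hr), neg_inj] at h3
  rw [← h3, sub_sub_cancel]

/-- Mollifications with `coneMollifier` converge at Lebesgue points. -/
theorem ae_tendsto_integral_coneMollifier_smul [CompleteSpace F] (hφ : LocallyIntegrable φ cylVolume)
    {n : E3} (hn : ‖n‖ = 1) :
    ∀ᵐ x ∂cylVolume, Tendsto (fun r => ∫ y, coneMollifier n r (y - x) • φ y ∂cylVolume) (𝓝[>] 0)
      (𝓝 ((∫ y, coneMollifier n 1 y) • φ x)) := by
  obtain ⟨M, hM0, hM⟩ := exists_abs_deriv_radialCutoff_le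
  set c := ∫ y, coneMollifier n 1 y
  have hc : 0 < c := integral_coneMollifier_pos hn
  -- Extension by zero makes Lebesgue differentiation on ℝ³ applicable.
  have hφ' : LocallyIntegrable (exteriorCylinder.indicator φ) volume := fun y => by
    obtain ⟨U, hU, h⟩ := hφ y
    refine ⟨U, hU, ?_⟩
    rw [IntegrableOn, integrable_indicator_iff measurableSet_exteriorCylinder, IntegrableOn,
      Measure.restrict_comm measurableSet_exteriorCylinder]
    exact h
  have hleb := (Besicovitch.vitaliFamily (volume : Measure E3)).ae_tendsto_average_norm_sub hφ'
  rw [cylVolume, ae_restrict_iff' measurableSet_exteriorCylinder]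
  filter_upwards [hleb] with x hx hxmem
  have h0 := hx.comp (Besicovitch.tendsto_filterAt volume x)
  have hev : ∀ᶠ r : ℝ in 𝓝[>] 0, 0 < r := self_mem_nhdsWithin
  -- The normalised kernels have integral one, live in the closed ball of radius r and are at most
  -- c⁻¹ · 4M r⁻³; the constant is this bound times |B_r| = r³ |B_1|.
  have h1 := tendsto_integral_smul_of_tendsto_average_norm_sub
    (g := fun r y => c⁻¹ * coneMollifier n r (y - x))
    (c⁻¹ * (4 * M) * volume.real (Metric.closedBall (0 : E3) 1)) h0
    (Eventually.of_forall fun r => hφ'.integrableOn_isCompact (isCompact_closedBall x r))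
    (tendsto_const_nhds.congr' (by
      filter_upwards [hev] with r hr
      rw [integral_const_mul, integral_sub_right_eq_self (fun y => coneMollifier n r y),
        integral_coneMollifier n hr, inv_mul_cancel₀ hc.ne']))
    (by
      filter_upwards [hev] with r hr y hy
      rw [mem_closedBall_iff_norm]
      by_contra! h
      exact hy (by simp [coneMollifier_eq_zero n hr h.le]))
    (by
      filter_upwards [hev] with r hr y
      have hvol : volume.real (Metric.closedBall x r) =
          r ^ 3 * volume.real (Metric.closedBall (0 : E3) 1) := by
        rw [measureReal_def, Measure.addHaar_closedBall' volume x hr.le, ENNReal.toReal_mul,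
          ENNReal.toReal_ofReal (by positivity), finrank_euclideanSpace_fin, measureReal_def]
      have hpos : 0 < volume.real (Metric.closedBall (0 : E3) 1) :=
        ENNReal.toReal_pos (Metric.measure_closedBall_pos volume 0 one_pos).ne'
          (isCompact_closedBall _ _).measure_lt_top.ne
      rw [hvol, abs_mul, abs_of_nonneg (inv_nonneg.2 hc.le),
        abs_of_nonneg (coneMollifier_nonneg n hr _), mul_div_mul_right _ _ hpos.ne', mul_div_assoc,
        div_eq_mul_inv, ← inv_pow]
      exact mul_le_mul_of_nonneg_left (coneMollifier_le_const hM n hr _) (by positivity))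
  rw [indicator_of_mem hxmem] at h1
  have h2 := h1.const_smul c
  refine h2.congr fun r => ?_
  rw [← integral_smul, ← integral_indicator measurableSet_exteriorCylinder]
  refine integral_congr_ae (ae_of_all _ fun y => ?_)
  simp only
  rw [smul_smul, mul_inv_cancel_left₀ hc.ne', indicator_smul_apply]

/-- A function with weak gradient in the exterior of the cylinder is bounded pointwise by a
truncated Riesz potential of the function and its gradient, at every scale. -/
theorem exists_enorm_le_lintegral_rieszKernel [CompleteSpace F] :
    ∃ A : ℝ≥0, ∀ (φ : E3 → F) (G : E3 → GradSpace F), IsWeakGradient φ G →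
      LocallyIntegrable φ cylVolume → LocallyIntegrable G cylVolume →
      ∀ᵐ x ∂cylVolume, ∀ R : ℝ, 0 < R → ‖φ x‖ₑ ≤
        A * ∫⁻ y, rieszKernel R (x - y) *
          exteriorCylinder.indicator (fun y => ENNReal.ofReal R⁻¹ * ‖φ y‖ₑ + ‖G y‖ₑ) y := by
  obtain ⟨M, hM0, hM⟩ := exists_abs_deriv_radialCutoff_le
  set c : Bool × Bool → ℝ := fun b => ∫ y, coneMollifier (coneDirection b) 1 y
  have hc (b) : 0 < c b := integral_coneMollifier_pos (norm_coneDirection b)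
  -- M serves the mollifier at scale R, and 3 the number of components of the test field.
  set N : ℝ≥0 := max M.toNNReal 3
  -- The direction depends on x; summing over all four gives one constant.
  refine ⟨∑ b, (c b).toNNReal⁻¹ * N, fun φ G hG hφ hG' => ?_⟩
  have hlim := ae_all_iff.2 fun b => ae_tendsto_integral_coneMollifier_smul hφ (norm_coneDirection b)
  filter_upwards [hlim, ae_restrict_mem measurableSet_exteriorCylinder] with x hx hxmem R hR
  obtain ⟨b, hcone⟩ := exists_cone_subset_exteriorCylinder hxmem
  set J := ∫⁻ y, rieszKernel R (x - y) *
    exteriorCylinder.indicator (fun y => ENNReal.ofReal R⁻¹ * ‖φ y‖ₑ + ‖G y‖ₑ) y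
  have hk (y : E3) : rieszKernel R (x - y) =
      ENNReal.ofReal ((Metric.ball x R).indicator (fun y => ‖x - y‖⁻¹ ^ 2) y) := by
    have hiff : x - y ∈ Metric.ball (0 : E3) R ↔ y ∈ Metric.ball x R := by
      rw [mem_ball_zero_iff, mem_ball_iff_norm']
    unfold rieszKernel
    by_cases hy : y ∈ Metric.ball x R
    · rw [indicator_of_mem hy, indicator_of_mem (hiff.2 hy)]
    · rw [indicator_of_notMem hy, indicator_of_notMem (hiff.not.2 hy), ENNReal.ofReal_zero]
  have hJ : J = ∫⁻ y, rieszKernel R (x - y) * (ENNReal.ofReal R⁻¹ * ‖φ y‖ₑ + ‖G y‖ₑ)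
      ∂cylVolume := by
    rw [cylVolume, ← lintegral_indicator measurableSet_exteriorCylinder]
    refine lintegral_congr fun y => ?_
    by_cases hy : y ∈ exteriorCylinder
    · simp only [indicator_of_mem hy]
    · simp only [indicator_of_notMem hy, mul_zero]
  -- Uniform in r, hence preserved in the limit r → 0.
  have hbound : ∀ r, 0 < r → r ≤ R →
      ‖∫ y, coneMollifier (coneDirection b) r (y - x) • φ y ∂cylVolume‖ₑ ≤ N * J := by
    intro r hr hrR
    have hmoll (y : E3) : ‖coneMollifier (coneDirection b) R (y - x) • φ y‖ₑ ≤
        N * (rieszKernel R (x - y) * (ENNReal.ofReal R⁻¹ * ‖φ y‖ₑ)) := by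
      rw [enorm_smul, Real.enorm_of_nonneg (coneMollifier_nonneg _ hR _), ← mul_assoc, ← mul_assoc]
      gcongr
      rw [hk, ← ENNReal.ofReal_coe_nnreal, ← ENNReal.ofReal_mul (by positivity),
        ← ENNReal.ofReal_mul (mul_nonneg (by positivity)
          (indicator_nonneg (fun _ _ => by positivity) _))]
      refine ENNReal.ofReal_le_ofReal ?_
      by_cases hy : y ∈ Metric.ball x R
      · rw [indicator_of_mem hy, norm_sub_rev]
        calc coneMollifier (coneDirection b) R (y - x) ≤ M * R⁻¹ * ‖y - x‖⁻¹ ^ 2 :=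
            coneMollifier_le hM _ hR _
          _ ≤ N * R⁻¹ * ‖y - x‖⁻¹ ^ 2 := by
            gcongr
            exact (Real.le_coe_toNNReal M).trans (NNReal.coe_le_coe.2 (le_max_left _ _))
          _ = _ := by ring
      · rw [indicator_of_notMem hy, coneMollifier_eq_zero _ hR, mul_zero, zero_mul]
        rwa [mem_ball_iff_norm, not_lt] at hy
    have htest (y : E3) : ‖∑ i, coneTest (coneDirection b) r R x i y • G y i‖ₑ ≤
        N * (rieszKernel R (x - y) * ‖G y‖ₑ) := by
      have h1 (i : Fin 3) : ‖coneTest (coneDirection b) r R x i y • G y i‖ₑ ≤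
          rieszKernel R (x - y) * ‖G y‖ₑ := by
        rw [enorm_smul, hk]
        gcongr
        · rw [← ofReal_norm, Real.norm_eq_abs]
          exact ENNReal.ofReal_le_ofReal (abs_coneTest_le hr hrR i y)
        · rw [enorm_le_iff_norm_le]
          exact PiLp.norm_apply_le _ i
      calc _ ≤ ∑ i, ‖coneTest (coneDirection b) r R x i y • G y i‖ₑ := enorm_sum_le _ _
        _ ≤ ∑ _i : Fin 3, rieszKernel R (x - y) * ‖G y‖ₑ := Finset.sum_le_sum fun i _ => h1 i
        _ = 3 * (rieszKernel R (x - y) * ‖G y‖ₑ) := by simp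
        _ ≤ _ := by
          gcongr
          exact_mod_cast le_max_right _ _
    rw [integral_coneMollifier_smul_sub hG hφ hG' hcone hr hrR]
    calc _ ≤ ‖∫ y, coneMollifier (coneDirection b) R (y - x) • φ y ∂cylVolume‖ₑ +
          ‖∫ y, ∑ i, coneTest (coneDirection b) r R x i y • G y i ∂cylVolume‖ₑ := enorm_sub_le
      _ ≤ ∫⁻ y, N * (rieszKernel R (x - y) * (ENNReal.ofReal R⁻¹ * ‖φ y‖ₑ)) ∂cylVolume +
          ∫⁻ y, N * (rieszKernel R (x - y) * ‖G y‖ₑ) ∂cylVolume :=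
        add_le_add
          ((enorm_integral_le_lintegral_enorm _).trans (lintegral_mono hmoll))
          ((enorm_integral_le_lintegral_enorm _).trans (lintegral_mono htest))
      _ = N * J := by
        have hmk : Measurable fun y => rieszKernel R (x - y) :=
          (measurable_rieszKernel R).comp (measurable_const.sub measurable_id)
        have hmG : AEMeasurable (fun y => ‖G y‖ₑ) cylVolume := hG'.aestronglyMeasurable.enorm
        rw [lintegral_const_mul' _ _ ENNReal.coe_ne_top, lintegral_const_mul' _ _ ENNReal.coe_ne_top,
          ← mul_add, hJ]
        simp_rw [mul_add]
        rw [lintegral_add_right' (g := fun y => rieszKernel R (x - y) * ‖G y‖ₑ) _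
          (hmk.aemeasurable.mul hmG), mul_add]
  have hle : ‖c b • φ x‖ₑ ≤ N * J := by
    refine le_of_tendsto (hx b).enorm ?_
    filter_upwards [Ioc_mem_nhdsGT hR] with r hr using hbound r hr.1 hr.2
  have hcb : (c b).toNNReal ≠ 0 := (Real.toNNReal_pos.2 (hc b)).ne'
  calc ‖φ x‖ₑ = ((c b).toNNReal⁻¹ : ℝ≥0) * ‖c b • φ x‖ₑ := by
        rw [enorm_smul, Real.enorm_of_nonneg (hc b).le, ← mul_assoc, ENNReal.ofReal,
          ← ENNReal.coe_mul, inv_mul_cancel₀ hcb, ENNReal.coe_one, one_mul]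
    _ ≤ ((c b).toNNReal⁻¹ : ℝ≥0) * (N * J) := by gcongr
    _ = (((c b).toNNReal⁻¹ * N : ℝ≥0) : ℝ≥0∞) * J := by rw [ENNReal.coe_mul, mul_assoc]
    _ ≤ _ := by
        gcongr
        exact Finset.single_le_sum (f := fun b => (c b).toNNReal⁻¹ * N) (fun _ _ => zero_le)
          (Finset.mem_univ b)

end Representation

/-! ### From the pointwise bound to the interpolation inequality. -/

section GagliardoNirenberg

/-- Young's inequality, with p = ∞ treated apart: there `h` makes s and q conjugate, and Hölder
suffices. -/
theorem eLpNorm_le_of_enorm_le_lintegral_rieszKernel {F : Type*} [NormedAddCommGroup F]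
    {p : ℝ≥0∞} {q s R : ℝ} (hs : 0 < s)
    (hq : 0 < q) (hsp : ENNReal.ofReal s ≤ p) (hqp : ENNReal.ofReal q ≤ p)
    (h : 1 + (1 / p).toReal = 1 / q + 1 / s) {A : ℝ≥0} {f : E3 → ℝ≥0∞} (hf : AEMeasurable f)
    {φ : E3 → F}
    (hφ : ∀ᵐ x ∂cylVolume, ‖φ x‖ₑ ≤ A * ∫⁻ y, rieszKernel R (x - y) * f y) :
    eLpNorm φ p cylVolume ≤
      A * ((∫⁻ y, rieszKernel R y ^ s) ^ (1 / s) * (∫⁻ y, f y ^ q) ^ (1 / q)) := by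
  have hp0 : p ≠ 0 := ((ENNReal.ofReal_pos.2 hs).trans_le hsp).ne'
  rcases eq_or_ne p ∞ with rfl | hp
  · have hsq : s.HolderConjugate q := by
      rw [Real.holderConjugate_iff]
      simp only [one_div, ENNReal.inv_top, ENNReal.toReal_zero, add_zero] at h
      refine ⟨?_, by linarith⟩
      have : 0 < q⁻¹ := inv_pos.2 hq
      exact (inv_lt_one₀ hs).1 (by linarith)
    rw [eLpNorm_exponent_top]
    refine eLpNormEssSup_le_of_ae_enorm_bound ?_
    filter_upwards [hφ] with x hx
    exact hx.trans (mul_le_mul_right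
      (lintegral_sub_mul_le_of_holderConjugate hsq (measurable_rieszKernel R) hf x) A)
  · have hp' : 0 < p.toReal := ENNReal.toReal_pos hp0 hp
    rw [eLpNorm_eq_lintegral_rpow_enorm_toReal hp0 hp]
    have hyoung := lintegral_rpow_lintegral_sub_mul_le (μ := (volume : Measure E3)) hs hq
      ((ENNReal.ofReal_le_iff_le_toReal hp).1 hsp) ((ENNReal.ofReal_le_iff_le_toReal hp).1 hqp)
      (by rw [← h]; simp) (measurable_rieszKernel R) hf
    calc (∫⁻ x, ‖φ x‖ₑ ^ p.toReal ∂cylVolume) ^ (1 / p.toReal)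
        ≤ (∫⁻ x, (A : ℝ≥0∞) ^ p.toReal * (∫⁻ y, rieszKernel R (x - y) * f y) ^ p.toReal) ^
            (1 / p.toReal) := by
          refine ENNReal.rpow_le_rpow (le_trans (lintegral_mono_ae ?_)
            (lintegral_mono' Measure.restrict_le_self le_rfl)) (by positivity)
          filter_upwards [hφ] with x hx
          rw [← ENNReal.mul_rpow_of_nonneg _ _ hp'.le]
          exact ENNReal.rpow_le_rpow hx hp'.le
      _ = A * (∫⁻ x, (∫⁻ y, rieszKernel R (x - y) * f y) ^ p.toReal) ^ (1 / p.toReal) := by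
          rw [lintegral_const_mul' _ _ (ENNReal.rpow_ne_top_of_nonneg hp'.le ENNReal.coe_ne_top),
            ENNReal.mul_rpow_of_nonneg _ _ (by positivity), ← ENNReal.rpow_mul,
            mul_one_div_cancel hp'.ne', ENNReal.rpow_one]
      _ ≤ _ := mul_le_mul_right hyoung A

variable {F : Type*} [NormedAddCommGroup F] [NormedSpace ℝ F]

/-- The `L^p` norm is controlled by the `L^q` norms of the function and of its gradient, at every
length scale `R`. -/
theorem exists_eLpNorm_le_at_scale [CompleteSpace F] {p q : ℝ≥0∞} (hq : 1 ≤ q) (hq' : q ≠ ⊤)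
    (hqp : q ≤ p) {σ : ℝ} (hσ : σ = 3 * ((1 / q).toReal - (1 / p).toReal)) (hσ1 : σ < 1) :
    ∃ K : ℝ≥0, ∀ (φ : E3 → F) (G : E3 → GradSpace F), IsWeakGradient φ G →
      MemLp φ q cylVolume → MemLp G q cylVolume → ∀ R : ℝ, 0 < R →
      eLpNorm φ p cylVolume ≤ K * ENNReal.ofReal (R ^ (1 - σ)) *
        (ENNReal.ofReal R⁻¹ * eLpNorm φ q cylVolume + eLpNorm G q cylVolume) := by
  obtain ⟨A, hA⟩ := exists_enorm_le_lintegral_rieszKernel (F := F)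
  have hq0 : q ≠ 0 := (one_pos.trans_le hq).ne'
  set t := q.toReal
  have ht1 : 1 ≤ t := by simpa using ENNReal.toReal_mono hq' hq
  have ht0 : 0 < t := one_pos.trans_le ht1
  have htq : ENNReal.ofReal t = q := ENNReal.ofReal_toReal hq'
  have hpq : (1 / p).toReal ≤ (1 / q).toReal :=
    ENNReal.toReal_mono (by simpa using hq0) (ENNReal.div_le_div_left hqp 1)
  have htinv : (1 / q).toReal = 1 / t := by simp [t]
  have hp0 : 0 ≤ (1 / p).toReal := ENNReal.toReal_nonneg
  have ht1' : 1 / t ≤ 1 := (div_le_one ht0).2 ht1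
  have hpos : 0 < 1 - σ / 3 := by linarith
  -- Young's relation forces 1/s = 1 + 1/p - 1/q = 1 - σ/3, and σ < 1 gives s < 3/2.
  set s := (1 - σ / 3)⁻¹ with hs_def
  have hs : 0 < s := inv_pos.2 hpos
  have hs1 : 1 / s = 1 - σ / 3 := by rw [hs_def, one_div, inv_inv]
  have hs' : s < 3 / 2 := by
    rw [hs_def, inv_lt_comm₀ hpos (by norm_num)]
    linarith
  have hsp : ENNReal.ofReal s ≤ p := by
    rw [← ENNReal.inv_le_inv, ← ENNReal.ofReal_inv_of_pos hs, ← one_div p,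
      ← ENNReal.ofReal_toReal (a := 1 / p) (by simpa using (hq0.bot_lt.trans_le hqp).ne')]
    refine ENNReal.ofReal_le_ofReal ?_
    rw [← one_div, hs1]
    linarith
  have hI := lintegral_rieszKernel_rpow_lt_top hs hs'
  set B : ℝ≥0∞ := (∫⁻ y, rieszKernel 1 y ^ s) ^ (1 / s)
  have hB : B ≠ ⊤ := ENNReal.rpow_ne_top_of_nonneg (by positivity) hI.ne
  refine ⟨A * B.toNNReal, fun φ G hG hφ hGq R hR => ?_⟩
  have hmφ : AEMeasurable (fun y => ENNReal.ofReal R⁻¹ * ‖φ y‖ₑ) cylVolume :=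
    hφ.1.enorm.const_mul _
  have hmG : AEMeasurable (fun y => ‖G y‖ₑ) cylVolume := hGq.1.enorm
  have hpt := hA φ G hG (hφ.locallyIntegrable hq) (hGq.locallyIntegrable hq)
  have h1 := eLpNorm_le_of_enorm_le_lintegral_rieszKernel hs ht0 hsp (htq.trans_le hqp)
    (by rw [hs1]; linarith)
    ((aemeasurable_indicator_iff measurableSet_exteriorCylinder).2 (hmφ.add hmG))
    (hpt.mono fun x hx => hx R hR)
  -- The exponent of R is (3 - 2s)/s = 3/s - 2 = 1 - σ.
  have h2 : (∫⁻ y, rieszKernel R y ^ s) ^ (1 / s) = ENNReal.ofReal (R ^ (1 - σ)) * B := by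
    rw [lintegral_rieszKernel_rpow hs hR, ENNReal.mul_rpow_of_nonneg _ _ (by positivity),
      ENNReal.ofReal_rpow_of_nonneg (by positivity) (by positivity), ← Real.rpow_mul hR.le]
    congr 3
    have : s * (1 / s) = 1 := mul_one_div_cancel hs.ne'
    linear_combination 3 * hs1 - 2 * this
  have h3 : (∫⁻ y, exteriorCylinder.indicator
      ((fun y => ENNReal.ofReal R⁻¹ * ‖φ y‖ₑ) + fun y => ‖G y‖ₑ) y ^ t) ^ (1 / t) ≤
      ENNReal.ofReal R⁻¹ * eLpNorm φ q cylVolume + eLpNorm G q cylVolume := by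
    have e : ∫⁻ y, exteriorCylinder.indicator
        ((fun y => ENNReal.ofReal R⁻¹ * ‖φ y‖ₑ) + fun y => ‖G y‖ₑ) y ^ t =
        ∫⁻ y, ((fun y => ENNReal.ofReal R⁻¹ * ‖φ y‖ₑ) + fun y => ‖G y‖ₑ) y ^ t ∂cylVolume := by
      rw [cylVolume, ← lintegral_indicator measurableSet_exteriorCylinder]
      refine lintegral_congr fun y => ?_
      by_cases hy : y ∈ exteriorCylinder
      · simp only [indicator_of_mem hy]
      · simp only [indicator_of_notMem hy, ENNReal.zero_rpow_of_pos ht0]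
    rw [e]
    refine (ENNReal.lintegral_Lp_add_le hmφ hmG ht1).trans_eq ?_
    rw [eLpNorm_eq_lintegral_rpow_enorm_toReal hq0 hq',
      eLpNorm_eq_lintegral_rpow_enorm_toReal hq0 hq']
    simp_rw [ENNReal.mul_rpow_of_nonneg _ _ ht0.le]
    rw [lintegral_const_mul' _ _ (ENNReal.rpow_ne_top_of_nonneg ht0.le ENNReal.ofReal_ne_top),
      ENNReal.mul_rpow_of_nonneg _ _ (by positivity), ← ENNReal.rpow_mul,
      mul_one_div_cancel ht0.ne', ENNReal.rpow_one]
  calc eLpNorm φ p cylVolume ≤ _ := h1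
    _ ≤ A * (ENNReal.ofReal (R ^ (1 - σ)) * B *
        (ENNReal.ofReal R⁻¹ * eLpNorm φ q cylVolume + eLpNorm G q cylVolume)) := by
      rw [h2]
      gcongr
    _ = _ := by
      rw [ENNReal.coe_mul, ENNReal.coe_toNNReal hB]
      ring

/-- If `x` is bounded by `K R ^ (1 - σ) (R⁻¹ a + b)` for all `R > 0` then it is bounded by a
multiple of `a ^ (1 - σ) b ^ σ`. -/
theorem le_rpow_mul_rpow_of_forall_scale {x a b : ℝ≥0∞} {K : ℝ≥0} {σ : ℝ} (hσ0 : 0 < σ)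
    (ha0 : a ≠ 0) (ha : a ≠ ⊤) (hb : b ≠ ⊤)
    (h : ∀ R : ℝ, 0 < R → x ≤ K * ENNReal.ofReal (R ^ (1 - σ)) * (ENNReal.ofReal R⁻¹ * a + b)) :
    x ≤ (2 * K : ℝ≥0) * a ^ (1 - σ) * b ^ σ := by
  lift a to ℝ≥0 using ha
  lift b to ℝ≥0 using hb
  have ha0' : a ≠ 0 := by simpa using ha0
  have hapos : 0 < a := pos_iff_ne_zero.2 ha0'
  -- For b = 0 the bound is K a R^{-σ}, which tends to zero as R → ∞ because σ > 0.
  rcases eq_or_ne b 0 with rfl | hb0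
  · have hlim : Tendsto (fun R : ℝ => (K * a : ℝ≥0∞) * ENNReal.ofReal (R ^ (-σ))) atTop (𝓝 0) := by
      have h1 := ENNReal.tendsto_ofReal (tendsto_rpow_neg_atTop hσ0)
      have h2 := ENNReal.Tendsto.const_mul h1
        (Or.inr (ENNReal.mul_ne_top (ENNReal.coe_ne_top (r := K)) (ENNReal.coe_ne_top (r := a))))
      simpa using h2
    have hx : x ≤ 0 := by
      refine ge_of_tendsto hlim ?_
      filter_upwards [eventually_gt_atTop (0 : ℝ)] with R hR
      refine (h R hR).trans_eq ?_
      have : R ^ (-σ) = R ^ (1 - σ) * R⁻¹ := by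
        rw [← Real.rpow_neg_one, ← Real.rpow_add hR]
        ring_nf
      rw [this, ENNReal.ofReal_mul (by positivity), ENNReal.coe_zero, add_zero]
      ring
    exact hx.trans zero_le
  · have hbpos : 0 < b := pos_iff_ne_zero.2 hb0
    -- R = a/b makes the two terms in the bracket equal, whence the factor 2.
    have hR := h ((a / b : ℝ≥0) : ℝ) (by positivity)
    rw [← NNReal.coe_rpow, ← NNReal.coe_inv, ENNReal.ofReal_coe_nnreal,
      ENNReal.ofReal_coe_nnreal] at hR
    rw [← ENNReal.coe_rpow_of_ne_zero ha0', ← ENNReal.coe_rpow_of_ne_zero hb0]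
    refine hR.trans_eq ?_
    norm_cast
    have h1 : (a / b)⁻¹ * a = b := by field_simp
    have h2 : b = b ^ (1 - σ) * b ^ σ := by
      rw [← NNReal.rpow_add hb0, sub_add_cancel, NNReal.rpow_one]
    rw [h1, NNReal.div_rpow, ← two_mul]
    have h3 : b ^ (1 - σ) ≠ 0 := (NNReal.rpow_pos hbpos).ne'
    calc K * (a ^ (1 - σ) / b ^ (1 - σ)) * (2 * b)
        = K * (a ^ (1 - σ) / b ^ (1 - σ)) * (2 * (b ^ (1 - σ) * b ^ σ)) := by rw [← h2]
      _ = 2 * K * a ^ (1 - σ) * b ^ σ := by field_simp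

/-- The **Gagliardo–Nirenberg inequality** in the exterior of the cylinder, in its homogeneous form.
No boundary condition is needed, since every point of the domain is the vertex of an infinite cone
contained in the domain. -/
theorem gagliardoNirenberg_exteriorCylinder [CompleteSpace F] {p q : ℝ≥0∞} (hq : 1 ≤ q)
    (hqp : q ≤ p) {σ : ℝ} (hσ : σ = 3 * ((1 / q).toReal - (1 / p).toReal)) (hσ1 : σ < 1) :
    ∃ C : ℝ≥0, ∀ (φ : E3 → F) (G : E3 → GradSpace F), MemLp φ q cylVolume → IsWeakGradient φ G →
      eLpNorm φ p cylVolume ≤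
        C * eLpNorm φ q cylVolume ^ (1 - σ) * eLpNorm G q cylVolume ^ σ := by
  have hq0 : q ≠ 0 := (one_pos.trans_le hq).ne'
  have hp0 : p ≠ 0 := (hq0.bot_lt.trans_le hqp).ne'
  rcases eq_or_ne q p with rfl | hne
  · refine ⟨1, fun φ G _ _ => ?_⟩
    simp [hσ]
  have hlt : q < p := lt_of_le_of_ne hqp hne
  have hσ0 : 0 < σ := by
    have : (1 / p).toReal < (1 / q).toReal :=
      (ENNReal.toReal_lt_toReal (by simpa using hp0) (by simpa using hq0)).2
        (by simpa using hlt)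
    linarith
  obtain ⟨K, hK⟩ := exists_eLpNorm_le_at_scale (F := F) hq hlt.ne_top hqp hσ hσ1
  -- The added 1 keeps the constant nonzero, so that the right side is really infinite when the
  -- gradient has infinite norm; in `ℝ≥0∞`, 0 · ∞ = 0.
  refine ⟨2 * K + 1, fun φ G hφ hG => ?_⟩
  have hmG : AEStronglyMeasurable G cylVolume := hG.locallyIntegrable_grad.aestronglyMeasurable
  rcases eq_or_ne (eLpNorm φ q cylVolume) 0 with ha0 | ha0
  · rw [eLpNorm_congr_ae ((eLpNorm_eq_zero_iff hφ.1 hq0).1 ha0), eLpNorm_zero]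
    exact zero_le
  rcases eq_or_ne (eLpNorm G q cylVolume) ⊤ with hb | hb
  · rw [hb, ENNReal.top_rpow_of_pos hσ0, ENNReal.mul_top]
    · exact le_top
    · exact mul_ne_zero (by simp) (ENNReal.rpow_pos ha0.bot_lt hφ.2.ne).ne'
  · refine (le_rpow_mul_rpow_of_forall_scale hσ0 ha0 hφ.2.ne hb
      (hK φ G hG hφ ⟨hmG, hb.lt_top⟩)).trans ?_
    gcongr
    exact le_self_add

end GagliardoNirenberg

theorem lemmaB1 {F : Type*} [NormedAddCommGroup F] [NormedSpace ℝ F] [FiniteDimensional ℝ F]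
    (p q : ℝ≥0∞) (hq : 1 ≤ q) (hqp : q ≤ p)
    (σ : ℝ) (hσ : σ = 3 * ((1 / q).toReal - (1 / p).toReal)) (hσ1 : σ < 1) :
    ∃ C : ℝ≥0,
      (∀ (φ : E3 → F) (G : E3 → GradSpace F), MemW10 q φ → IsWeakGradient φ G →
        eLpNorm φ p cylVolume ≤
          C * eLpNorm φ q cylVolume ^ (1 - σ) * eLpNorm G q cylVolume ^ σ) ∧
      (∀ (φ : E3 → F) (G : E3 → GradSpace F), MemW1 q φ → IsWeakGradient φ G →
        eLpNorm φ p cylVolume ≤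
          C * eLpNorm φ q cylVolume ^ (1 - σ) *
            (eLpNorm φ q cylVolume + eLpNorm G q cylVolume) ^ σ) := by
  have : CompleteSpace F := FiniteDimensional.complete ℝ F
  obtain ⟨C, hC⟩ := gagliardoNirenberg_exteriorCylinder (F := F) hq hqp hσ hσ1
  have hσ0 : 0 ≤ σ := by
    have : (1 / p).toReal ≤ (1 / q).toReal :=
      ENNReal.toReal_mono (by simpa using (one_pos.trans_le hq).ne')
        (ENNReal.div_le_div_left hqp 1)
    linarith
  -- The second bound follows by monotonicity of t ↦ t^σ, as σ ≥ 0.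
  refine ⟨C, fun φ G hφ hG => hC φ G hφ.1.1 hG, fun φ G hφ hG => (hC φ G hφ.1 hG).trans ?_⟩
  gcongr
  exact le_add_self
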